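/- Let $N\ge 1$ be an integer and let $\delta>0$ be a real number. For $i\in\mathbb{Z}/3$ define, on the affine chart $\{z_{i-1}\neq 0\}\subset\mathbb{CP}^2$, the function $$f_i([z_1:z_2:z_3])=\left(\frac{|z_i|}{|z_{i-1}|}\right)^{2N}+\left(\frac{|z_{i+1}|}{|z_{i-1}|}\right)^{2N}$$ (indices modulo $3$), and put $\widetilde X_i=f_i^{-1}\big((-\infty,2+\delta)\big)$, an open subset of $\mathbb{CP}^2$. Then $(\widetilde X_1,\widetilde X_2,\widetilde X_3)$ is a $(1,0)$-Stein trisection of $\mathbb{CP}^2$; in particular, $\mathbb{CP}^2$ admits a $(1,0)$-Stein trisection. That is, where $B^m$ and $D^2$ denote open balls and diffeomorphisms are smooth over $\mathbb{R}$: 1. $\widetilde X_1\cup\widetilde X_2\cup\widetilde X_3=\mathbb{CP}^2$; 2. each $\widetilde X_i$, with the complex structure induced from $\mathbb{CP}^2$, is a Stein manifold, i.e. it is Hausdorff, paracompact and holomorphically convex, its global holomorphic functions separate points, and near each of its points some global holomorphic functions form a local coordinate system; 3. each $\widetilde X_i$ is diffeomorphic to $B^4$; 4. each $\widetilde X_i\cap\widetilde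 X_{i+1}$ is diffeomorphic to $S^1\times B^3$; 5. $\widetilde X_1\cap\widetilde X_2\cap\widetilde X_3$ is diffeomorphic to $T^2\times D^2$. -/

import Mathlib

open scoped Manifold ContDiff LinearAlgebra.Projectivization
open TopologicalSpace

noncomputable section

/-! ### The complex projective plane as a complex surface -/

/-- The complex projective plane: lines through the origin in `ℂ³`. -/
abbrev CP2 : Type := ℙ ℂ (Fin 3 → ℂ)

namespace CP2

/-- The quotient topology coming from `ℂ³ ∖ {0}`. -/
instance instTopologicalSpace : TopologicalSpace CP2 :=
  inferInstanceAs (TopologicalSpace (Quotient (projectivizationSetoid ℂ (Fin 3 → ℂ))))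

theorem isQuotientMap_mk' :
    Topology.IsQuotientMap (Projectivization.mk' ℂ : {v : Fin 3 → ℂ // v ≠ 0} → CP2) :=
  isQuotientMap_quotient_mk'

/-- The set of points whose `i`-th homogeneous coordinate is nonzero. -/
def chartDomain (i : Fin 3) : Set CP2 :=
  {p | Projectivization.lift (fun v : {v : Fin 3 → ℂ // v ≠ 0} => v.1 i ≠ 0) (by
    rintro ⟨a, ha⟩ ⟨b, hb⟩ t (rfl : a = t • b)
    have ht : t ≠ 0 := by rintro rfl; simp at ha
    simp [ht]) p}

/-- The ratio `z_j / z_i` of homogeneous coordinates (meaningful on `chartDomain i`). -/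
def ratio (j i : Fin 3) (p : CP2) : ℂ :=
  Projectivization.lift (fun v : {v : Fin 3 → ℂ // v ≠ 0} => v.1 j / v.1 i) (by
    rintro ⟨a, ha⟩ ⟨b, hb⟩ t (rfl : a = t • b)
    have ht : t ≠ 0 := by rintro rfl; simp at ha
    simp [mul_div_mul_left _ _ ht]) p

@[simp] theorem mk_mem_chartDomain (i : Fin 3) (v : Fin 3 → ℂ) (hv : v ≠ 0) :
    Projectivization.mk ℂ v hv ∈ chartDomain i ↔ v i ≠ 0 := Iff.rfl

@[simp] theorem ratio_mk (j i : Fin 3) (v : Fin 3 → ℂ) (hv : v ≠ 0) :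
    ratio j i (Projectivization.mk ℂ v hv) = v j / v i := rfl

theorem isOpen_chartDomain (i : Fin 3) : IsOpen (chartDomain i) := by
  rw [← isQuotientMap_mk'.isOpen_preimage]
  change IsOpen {v : {v : Fin 3 → ℂ // v ≠ 0} | v.1 i ≠ 0}
  exact isOpen_ne_fun ((continuous_apply i).comp continuous_subtype_val) continuous_const

theorem continuousOn_ratio (j i : Fin 3) : ContinuousOn (ratio j i) (chartDomain i) := by
  rw [isQuotientMap_mk'.continuousOn_isOpen_iff (isOpen_chartDomain i)]
  change ContinuousOn (fun v : {v : Fin 3 → ℂ // v ≠ 0} => v.1 j / v.1 i) {v | v.1 i ≠ 0}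
  exact ContinuousOn.div ((continuous_apply j).comp continuous_subtype_val).continuousOn
    ((continuous_apply i).comp continuous_subtype_val).continuousOn (fun v hv => hv)

theorem exists_mem_chartDomain (p : CP2) : ∃ i, p ∈ chartDomain i := by
  induction p using Projectivization.ind with
  | h v hv => simpa [Function.ne_iff] using hv

theorem insertNth_one_ne_zero (i : Fin 3) (x : Fin 2 → ℂ) :
    (i.insertNth (1 : ℂ) x : Fin 3 → ℂ) ≠ 0 := fun h => by
  have := congrFun h i
  simp at this

/-- The affine chart `[z₀ : z₁ : z₂] ↦ (z_j / z_i)_{j ≠ i}`, with inverse inserting `1` in the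
`i`-th place. -/
def affineChart (i : Fin 3) : OpenPartialHomeomorph CP2 (Fin 2 → ℂ) where
  toFun p j := ratio (i.succAbove j) i p
  invFun x := Projectivization.mk ℂ (i.insertNth (1 : ℂ) x) (insertNth_one_ne_zero i x)
  source := chartDomain i
  target := Set.univ
  map_source' _ _ := Set.mem_univ _
  map_target' x _ := by simp
  left_inv' p hp := by
    induction p using Projectivization.ind with
    | h v hv =>
      rw [mk_mem_chartDomain] at hp
      rw [Projectivization.mk_eq_mk_iff']
      refine ⟨(v i)⁻¹, ?_⟩
      rw [Fin.eq_insertNth_iff]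
      refine ⟨by simp [hp], ?_⟩
      ext j
      simp [Fin.removeNth, div_eq_inv_mul]
  right_inv' x _ := by
    ext j
    simp
  open_source := isOpen_chartDomain i
  open_target := isOpen_univ
  continuousOn_toFun := continuousOn_pi.2 fun j => continuousOn_ratio _ _
  continuousOn_invFun := by
    refine Continuous.continuousOn ?_
    have h : Continuous fun x : Fin 2 → ℂ =>
        (⟨i.insertNth (1 : ℂ) x, insertNth_one_ne_zero i x⟩ : {v : Fin 3 → ℂ // v ≠ 0}) :=
      Continuous.subtype_mk (Continuous.finInsertNth (A := fun _ => ℂ) i continuous_const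
        continuous_id) _
    exact isQuotientMap_mk'.continuous.comp h

/-- The three affine charts. -/
instance instChartedSpace : ChartedSpace (Fin 2 → ℂ) CP2 where
  atlas := Set.range affineChart
  chartAt p := affineChart (exists_mem_chartDomain p).choose
  mem_chart_source p := (exists_mem_chartDomain p).choose_spec
  chart_mem_atlas _ := Set.mem_range_self _

/-- The affine charts are holomorphically compatible: `CP2` is a complex surface. -/
instance instIsManifold : IsManifold 𝓘(ℂ, Fin 2 → ℂ) ω CP2 := by
  apply isManifold_of_contDiffOn
  rintro _ _ ⟨i, rfl⟩ ⟨k, rfl⟩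
  have hc : ∀ l : Fin 3, ContDiff ℂ ω fun x : Fin 2 → ℂ => (i.insertNth (1 : ℂ) x : Fin 3 → ℂ) l := by
    intro l
    rcases Fin.eq_self_or_eq_succAbove i l with rfl | ⟨m, rfl⟩
    · simpa using contDiff_const
    · simpa using contDiff_apply ℂ ℂ m
  rw [contDiffOn_pi]
  intro j
  refine ContDiffOn.div (hc (k.succAbove j)).contDiffOn (hc k).contDiffOn ?_
  rintro x ⟨⟨-, hx⟩, -⟩
  exact hx

end CP2

/-! ### Stein manifolds -/

section Stein

variable (n : ℕ) (M : Type*) [TopologicalSpace M] [ChartedSpace (Fin n → ℂ) M]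

/-- Holomorphic functions `M → ℂ`. -/
def IsHolomorphicFun (f : M → ℂ) : Prop :=
  MDifferentiable 𝓘(ℂ, Fin n → ℂ) 𝓘(ℂ, ℂ) f

/-- The holomorphically convex hull `{x | |f x| ≤ sup_K |f| for all holomorphic f}`. -/
def holomorphicHull (K : Set M) : Set M :=
  {x | ∀ f : M → ℂ, IsHolomorphicFun n M f → ∀ C : ℝ, (∀ y ∈ K, ‖f y‖ ≤ C) → ‖f x‖ ≤ C}

/-- A Stein manifold of dimension `n`: a (Hausdorff) paracompact complex manifold which is
holomorphically convex, whose global holomorphic functions separate points, and near each point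
of which some global holomorphic functions form a local coordinate system. Here a local
coordinate system is a member of the maximal holomorphic atlas. -/
structure IsSteinManifold [IsManifold 𝓘(ℂ, Fin n → ℂ) ω M] : Prop where
  t2Space : T2Space M
  paracompactSpace : ParacompactSpace M
  holomorphicallyConvex : ∀ K : Set M, IsCompact K → IsCompact (holomorphicHull n M K)
  separatesPoints : ∀ x y : M, x ≠ y → ∃ f : M → ℂ, IsHolomorphicFun n M f ∧ f x ≠ f y
  localCoordinates : ∀ x : M, ∃ f : Fin n → M → ℂ, (∀ j, IsHolomorphicFun n M (f j)) ∧
    ∃ φ ∈ IsManifold.maximalAtlas 𝓘(ℂ, Fin n → ℂ) ω M,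
      x ∈ φ.source ∧ ∀ y ∈ φ.source, ∀ j, φ y j = f j y

end Stein

/-! ### Stein trisections of type `(1, 0)` -/

/-- The open unit ball `B^m`, as an open submanifold of Euclidean space. -/
def openUnitBall (m : ℕ) : Opens (EuclideanSpace ℝ (Fin m)) :=
  ⟨Metric.ball 0 1, Metric.isOpen_ball⟩

/-- A `(1, 0)`-Stein trisection of a complex surface `X`, i.e. a `(g; k₁, k₂, k₃)`-Stein
trisection with `g = 1` and `k₁ = k₂ = k₃ = 0`: the model of the pieces is
`♮⁰(S¹ × B³) = B⁴`, that of the double intersections is `♮¹(S¹ × B³) = S¹ × B³`, and that of the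
triple intersection is `Σ₁ × D² = T² × D²`. The pieces are open subsets of `X` with the induced
complex structure; diffeomorphisms are smooth over `ℝ`. Indices are cyclic modulo `3`. -/
structure IsSteinTrisectionOneZero {X : Type*} [TopologicalSpace X] [ChartedSpace (Fin 2 → ℂ) X]
    [IsManifold 𝓘(ℂ, Fin 2 → ℂ) ω X] (Z : Fin 3 → Opens X) : Prop where
  stein : ∀ i, IsSteinManifold 2 (Z i)
  cover : ⨆ i, Z i = ⊤
  piece : ∀ i, Nonempty
    (Diffeomorph 𝓘(ℝ, Fin 2 → ℂ) (𝓡 4) (Z i) (openUnitBall 4) ∞)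
  double : ∀ i, Nonempty
    (Diffeomorph 𝓘(ℝ, Fin 2 → ℂ) ((𝓡 1).prod (𝓡 3))
      (Z i ⊓ Z (i + 1) : Opens X) (Circle × openUnitBall 3) ∞)
  triple : Nonempty
    (Diffeomorph 𝓘(ℝ, Fin 2 → ℂ) (((𝓡 1).prod (𝓡 1)).prod (𝓡 2))
      (Z 0 ⊓ Z 1 ⊓ Z 2 : Opens X) ((Circle × Circle) × openUnitBall 2) ∞)

/-! ### The pieces in the projective plane -/

namespace CP2

/-- `f_i = (|z_i| / |z_{i-1}|)^{2N} + (|z_{i+1}| / |z_{i-1}|)^{2N}`, a function on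
`chartDomain (i - 1)`, where `z_{i-1} ≠ 0`. -/
def steinFun (N : ℕ) (i : Fin 3) (p : CP2) : ℝ :=
  ‖ratio i (i - 1) p‖ ^ (2 * N) + ‖ratio (i + 1) (i - 1) p‖ ^ (2 * N)

/-- The sublevel set `f_i⁻¹(-∞, 2 + δ)`, contained in the domain `z_{i-1} ≠ 0` of `f_i`. -/
def steinPiece (N : ℕ) (δ : ℝ) (i : Fin 3) : Opens CP2 where
  carrier := {p ∈ chartDomain (i - 1) | steinFun N i p < 2 + δ}
  is_open' := by
    have h : ContinuousOn (steinFun N i) (chartDomain (i - 1)) :=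
      ((continuousOn_ratio _ _).norm.pow _).add ((continuousOn_ratio _ _).norm.pow _)
    exact h.isOpen_inter_preimage (isOpen_chartDomain _) isOpen_Iio

end CP2

end

/-! In the chart z_{i-1} = 1 with coordinates x, y, put a = |x|^{2N}, b = |y|^{2N} and R = 2 + δ.
Clearing denominators, the three pieces become a + b < R, b + 1 < Ra and 1 + a < Rb, which are
affine in (a, b). One piece is therefore a domain in ℂ². On a double intersection x ≠ 0, and polar
coordinates in x split off a circle and leave a domain in the (a, y)-space ℝ × ℂ. On the triple
intersection both x and y are nonzero, and two circles split off from a triangle in the (a,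
b)-plane.

Each of these domains is bounded and cut out by inequalities h_j > 0 with h_j(p) > Dh_j(p)(p - p₀)
for a base point p₀. `nonempty_diffeomorph_of_star` spreads such a domain over the whole space along
rays from p₀: the factor ∑ 1/h_j blows up at the boundary, and the inequality makes the map strictly
monotone on every ray. The pieces cover because dividing by a coordinate of largest modulus makes f
at most 2.

For holomorphic convexity f_i serves as an exhaustion. Given a point (x, y), the holomorphic
function (z, w) ↦ x̄^N z^N + ȳ^N w^N takes the value f_i(x, y) there, and Cauchy–Schwarz
(`norm_conj_pow_mul_add_sq_le`) bounds it elsewhere. Hence hulls stay inside sublevel sets, which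
are compact. The affine coordinates separate points and are local coordinates. -/

/-! ### Diffeomorphisms between open submanifolds -/

section StarDomain

/-- The open unit ball is diffeomorphic to the whole Euclidean space. -/
theorem nonempty_diffeomorph_openUnitBall (m : ℕ) :
    Nonempty (Diffeomorph (𝓡 m) (𝓡 m) (EuclideanSpace ℝ (Fin m)) (openUnitBall m) ∞) := by
  let e : OpenPartialHomeomorph (EuclideanSpace ℝ (Fin m)) (EuclideanSpace ℝ (Fin m)) :=
    OpenPartialHomeomorph.univUnitBall
  have hs : ∀ x, x ∈ e.source := fun x => Set.mem_univ x
  have ht : ∀ x : openUnitBall m, x.1 ∈ e.target := fun x => x.2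
  refine ⟨⟨⟨fun x => ⟨e x, e.map_source (hs x)⟩, fun x => e.symm x, fun x => e.left_inv (hs x),
    fun x => Subtype.ext (e.right_inv (ht x))⟩, ?_, ?_⟩⟩
  · rw [← ContMDiff.subtypeVal_comp_iff]
    exact (OpenPartialHomeomorph.contDiff_univUnitBall
      (E := EuclideanSpace ℝ (Fin m)) (n := ⊤)).contMDiff
  · exact (OpenPartialHomeomorph.contDiffOn_univUnitBall_symm
      (E := EuclideanSpace ℝ (Fin m)) (n := ⊤)).contMDiffOn.comp_contMDiff
        contMDiff_subtype_val ht

variable {E : Type*} [NormedAddCommGroup E] [NormedSpace ℝ E]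

/-- A smooth injective map with invertible derivatives from an open set onto the whole space is a
diffeomorphism. -/
theorem nonempty_diffeomorph_of_hasFDerivAt [CompleteSpace E] (W : Opens E) (F : E → E)
    (hF : ∀ p ∈ W, ContDiffAt ℝ ∞ F p)
    (hF' : ∀ p ∈ W, ∃ L : E ≃L[ℝ] E, HasFDerivAt F (L : E →L[ℝ] E) p)
    (hinj : Set.InjOn F W) (hsurj : ∀ w, ∃ p ∈ W, F p = w) :
    Nonempty (Diffeomorph 𝓘(ℝ, E) 𝓘(ℝ, E) W E ∞) := by
  choose g hgW hFg using hsurj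
  refine ⟨⟨⟨fun p => F p, fun w => ⟨g w, hgW w⟩,
    fun p => Subtype.ext (hinj (hgW _) p.2 (hFg _)), hFg⟩, ?_, ?_⟩⟩
  · intro p
    exact (hF p p.2).contMDiffAt.comp p contMDiff_subtype_val.contMDiffAt
  · rw [← ContMDiff.subtypeVal_comp_iff]
    refine ContDiff.contMDiff (contDiff_iff_contDiffAt.2 fun w => ?_)
    obtain ⟨L, hL⟩ := hF' (g w) (hgW w)
    have hn : (∞ : ℕ∞ω) ≠ 0 := by simp
    have hloc := (hF _ (hgW w)).to_localInverse hL hn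
    have hstrict := (hF _ (hgW w)).hasStrictFDerivAt' hL hn
    have hright := hstrict.eventually_right_inverse
    have hcont : ContinuousAt (hstrict.localInverse F L (g w)) (F (g w)) :=
      hstrict.localInverse_continuousAt
    have hmem : ∀ᶠ y in nhds (F (g w)), hstrict.localInverse F L (g w) y ∈ W :=
      hcont.eventually_mem (by rw [hstrict.localInverse_apply_image]; exact W.2.mem_nhds (hgW w))
    rw [hFg w] at hloc hright hmem
    -- The local inverse stays in W near w, so injectivity on W identifies it with the chosen `g`;
    -- no continuity of `g` is needed beforehand.
    refine hloc.congr_of_eventuallyEq ?_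
    filter_upwards [hright, hmem] with y hy hyW
    exact hinj (hgW y) hyW ((hFg y).trans hy.symm)

variable {h : E → ℝ} {p₀ : E}

/-- If `h p > Dh(p) (p - p₀)` everywhere, then `h` grows less than linearly along rays from
`p₀`. -/
theorem lt_mul_of_fderiv_lt (hd : Differentiable ℝ h)
    (hstar : ∀ p, fderiv ℝ h p (p - p₀) < h p) (w : E) {t : ℝ} (ht : 1 < t) :
    h (p₀ + t • w) < t * h (p₀ + w) := by
  have hder : ∀ s : ℝ, HasDerivAt (fun s : ℝ => h (p₀ + s • w)) (fderiv ℝ h (p₀ + s • w) w) s := by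
    intro s
    have h1 : HasDerivAt (fun s : ℝ => p₀ + s • w) w s := by
      simpa using ((hasDerivAt_id s).smul_const w).const_add p₀
    exact (hd _).hasFDerivAt.comp_hasDerivAt s h1
  have hder2 : ∀ s : ℝ, 0 < s → HasDerivAt (fun s : ℝ => h (p₀ + s • w) / s)
      ((fderiv ℝ h (p₀ + s • w) w * s - h (p₀ + s • w) * 1) / s ^ 2) s := fun s hs =>
    (hder s).div (hasDerivAt_id s) hs.ne'
  -- The numerator of the derivative is s · Dh(w) - h at p₀ + s • w, which is negative by `hstar`.
  have hanti : StrictAntiOn (fun s : ℝ => h (p₀ + s • w) / s) (Set.Ioi 0) := by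
    refine strictAntiOn_of_deriv_neg (convex_Ioi 0)
      (fun s hs => (hder2 s hs).continuousAt.continuousWithinAt) fun s hs => ?_
    rw [interior_Ioi] at hs
    have hs' : 0 < s := hs
    rw [(hder2 s hs').deriv]
    have := hstar (p₀ + s • w)
    rw [add_sub_cancel_left, map_smul, smul_eq_mul] at this
    exact div_neg_of_neg_of_pos (by linarith) (by positivity)
  have := hanti (Set.mem_Ioi.2 one_pos) (Set.mem_Ioi.2 (one_pos.trans ht)) ht
  simp only [one_smul, div_one] at this
  rwa [div_lt_iff₀ (one_pos.trans ht), mul_comm] at this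

/-- A bounded domain cut out by finitely many inequalities `h j > 0`, where each `h j` satisfies
`h j p > D(h j)(p) (p - p₀)` and `p₀` is in the domain, is diffeomorphic to the whole space: push
along the rays from `p₀` by `p ↦ (∑ j, 1 / h j p) • (p - p₀)`. -/
theorem nonempty_diffeomorph_of_star [FiniteDimensional ℝ E] {ι : Type*} [Fintype ι] [Nonempty ι]
    (h : ι → E → ℝ) (hsm : ∀ j, ContDiff ℝ ∞ (h j)) (p₀ : E) (hp₀ : ∀ j, 0 < h j p₀)
    (hstar : ∀ j p, fderiv ℝ (h j) p (p - p₀) < h j p) (W : Opens E)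
    (hW : ∀ p, p ∈ W ↔ ∀ j, 0 < h j p) (hbdd : Bornology.IsBounded (W : Set E)) :
    Nonempty (Diffeomorph 𝓘(ℝ, E) 𝓘(ℝ, E) W E ∞) := by
  have : CompleteSpace E := FiniteDimensional.complete ℝ E
  have hd : ∀ j, Differentiable ℝ (h j) := fun j => (hsm j).differentiable (by simp)
  set ψ : E → ℝ := fun p => ∑ j, (h j p)⁻¹ with hψ
  have hpos : ∀ p ∈ W, 0 < ψ p := fun p hp =>
    Finset.sum_pos (fun j _ => inv_pos.2 ((hW p).1 hp j)) Finset.univ_nonempty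
  have hψsm : ∀ p ∈ W, ContDiffAt ℝ ∞ ψ p := fun p hp =>
    ContDiffAt.sum fun j _ => (hsm j).contDiffAt.inv ((hW p).1 hp j).ne'
  have hψd : ∀ p ∈ W, fderiv ℝ ψ p (p - p₀) = ∑ j, -fderiv ℝ (h j) p (p - p₀) / h j p ^ 2 := by
    intro p hp
    have h1 : HasFDerivAt ψ (∑ j, (-(h j p ^ 2)⁻¹) • fderiv ℝ (h j) p) p :=
      HasFDerivAt.fun_sum fun j _ =>
        (hasDerivAt_inv ((hW p).1 hp j).ne').comp_hasFDerivAt p (hd j p).hasFDerivAt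
    rw [h1.fderiv, sum_apply]
    refine Finset.sum_congr rfl fun j _ => ?_
    simp only [smul_apply, smul_eq_mul]
    ring
  -- This is the radial derivative of p ↦ ψ p • (p - p₀); it equals ∑ (h_j - Dh_j(p - p₀)) / h_j².
  have hrad : ∀ p ∈ W, 0 < ψ p + fderiv ℝ ψ p (p - p₀) := by
    intro p hp
    rw [hψd p hp, hψ, ← Finset.sum_add_distrib]
    refine Finset.sum_pos (fun j _ => ?_) Finset.univ_nonempty
    have hj := (hW p).1 hp j
    have : (h j p)⁻¹ + -fderiv ℝ (h j) p (p - p₀) / h j p ^ 2 =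
        (h j p - fderiv ℝ (h j) p (p - p₀)) / h j p ^ 2 := by
      field_simp
      ring
    rw [this]
    exact div_pos (sub_pos.2 (hstar j p)) (by positivity)
  have hmono : ∀ (w : E) (t : ℝ), 1 < t → p₀ + w ∈ W → p₀ + t • w ∈ W →
      ψ (p₀ + w) < t * ψ (p₀ + t • w) := by
    intro w t ht h1 h2
    simp only [hψ]
    rw [Finset.mul_sum]
    refine Finset.sum_lt_sum_of_nonempty Finset.univ_nonempty fun j _ => ?_
    have hj1 := (hW _).1 h1 j
    have hj2 := (hW _).1 h2 j
    rw [← div_eq_mul_inv, inv_eq_one_div, div_lt_div_iff₀ hj1 hj2, one_mul]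
    exact lt_mul_of_fderiv_lt (hd j) (hstar j) w ht
  refine nonempty_diffeomorph_of_hasFDerivAt W (fun p => ψ p • (p - p₀)) ?_ ?_ ?_ ?_
  · exact fun p hp => (hψsm p hp).smul (contDiffAt_id.sub contDiffAt_const)
  · intro p hp
    have h1 : HasFDerivAt (fun p => ψ p • (p - p₀))
        (ψ p • ContinuousLinearMap.id ℝ E + (fderiv ℝ ψ p).smulRight (p - p₀)) p :=
      ((hψsm p hp).differentiableAt (by simp)).hasFDerivAt.smul ((hasFDerivAt_id p).sub_const p₀)
    set A := ψ p • ContinuousLinearMap.id ℝ E + (fderiv ℝ ψ p).smulRight (p - p₀) with hA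
    -- A kernel vector must be a multiple of p - p₀, and in that direction A is multiplication by
    -- the positive number of `hrad`.
    have hinj : Function.Injective A.toLinearMap := by
      rw [← LinearMap.ker_eq_bot, LinearMap.ker_eq_bot']
      intro v hv
      have hv' : ψ p • v + fderiv ℝ ψ p v • (p - p₀) = 0 := by simpa [hA] using hv
      have hv2 : v = (-(fderiv ℝ ψ p v) / ψ p) • (p - p₀) := by
        have h3 : ψ p • v = (-(fderiv ℝ ψ p v)) • (p - p₀) := by
          rw [neg_smul]; exact eq_neg_of_add_eq_zero_left hv'
        rw [div_eq_inv_mul, mul_smul, ← h3, smul_smul, inv_mul_cancel₀ (hpos p hp).ne', one_smul]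
      generalize -(fderiv ℝ ψ p v) / ψ p = c at hv2
      subst hv2
      rw [map_smul, smul_smul, ← add_smul, smul_eq_mul, mul_comm (ψ p), ← mul_add, mul_smul,
        smul_comm] at hv'
      exact (smul_eq_zero.1 hv').resolve_left (hrad p hp).ne'
    refine ⟨(LinearEquiv.ofInjectiveEndo A.toLinearMap hinj).toContinuousLinearEquiv, ?_⟩
    have hL : ((LinearEquiv.ofInjectiveEndo A.toLinearMap hinj).toContinuousLinearEquiv :
        E →L[ℝ] E) = A := by
      ext v
      rfl
    rwa [hL]
  · intro p hp q hq hpq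
    have key : ∀ (w : E) (t : ℝ), 1 < t → p₀ + w ∈ W → p₀ + t • w ∈ W →
        ψ (p₀ + w) • w = ψ (p₀ + t • w) • t • w → w = 0 := by
      intro w t ht h1 h2 heq
      by_contra hw
      rw [smul_smul] at heq
      have := smul_left_injective ℝ hw heq
      exact absurd this (by rw [mul_comm]; exact (hmono w t ht h1 h2).ne)
    have hpq' : ψ p • (p - p₀) = ψ q • (q - p₀) := hpq
    have hp' := hpos p hp
    have hq' := hpos q hq
    -- Equal images put p and q on the same ray from p₀, so monotonicity along that ray decides.
    have e1 : q - p₀ = (ψ p / ψ q) • (p - p₀) := by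
      rw [div_eq_inv_mul, mul_smul, hpq', smul_smul, inv_mul_cancel₀ hq'.ne', one_smul]
    have e2 : p - p₀ = (ψ q / ψ p) • (q - p₀) := by
      rw [div_eq_inv_mul, mul_smul, ← hpq', smul_smul, inv_mul_cancel₀ hp'.ne', one_smul]
    rcases lt_trichotomy (ψ p / ψ q) 1 with hlt | heq | hgt
    · have hgt : 1 < ψ q / ψ p := by
        rw [div_lt_one hq'] at hlt
        rwa [one_lt_div hp']
      have := key (q - p₀) _ hgt (by simpa using hq) (by rw [← e2]; simpa using hp)
        (by rw [← e2]; simpa using hpq'.symm)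
      rw [this, smul_zero] at e2
      rw [sub_eq_zero.1 this, sub_eq_zero.1 e2]
    · rw [heq, one_smul] at e1
      exact (sub_left_injective e1).symm
    · have := key (p - p₀) _ hgt (by simpa using hp) (by rw [← e1]; simpa using hq)
        (by rw [← e1]; simpa using hpq')
      rw [this, smul_zero] at e1
      rw [sub_eq_zero.1 this, sub_eq_zero.1 e1]
  · intro w
    have hp₀W : p₀ ∈ W := (hW p₀).2 hp₀
    rcases eq_or_ne w 0 with rfl | hw
    · exact ⟨p₀, hp₀W, by simp⟩
    have hcr : Continuous fun t : ℝ => p₀ + t • w := by fun_prop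
    -- Surjectivity is checked ray by ray: T, the infimum of S, is the first exit time from W in the
    -- direction w.
    set S : Set ℝ := {t | 0 ≤ t ∧ p₀ + t • w ∉ W}
    have hSclosed : IsClosed S :=
      isClosed_Ici.inter (W.2.isClosed_compl.preimage hcr)
    have hSne : S.Nonempty := by
      obtain ⟨C, hC⟩ := hbdd.exists_norm_le
      -- A displacement of length |C| + ‖p₀‖ + 1 from p₀ leaves the ball of radius C.
      refine ⟨(|C| + ‖p₀‖ + 1) / ‖w‖, by positivity, fun hmem => ?_⟩
      have h1 := hC _ hmem
      have h2 : ‖((|C| + ‖p₀‖ + 1) / ‖w‖) • w‖ = |C| + ‖p₀‖ + 1 := by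
        rw [norm_smul, Real.norm_of_nonneg (by positivity), div_mul_cancel₀ _ (norm_ne_zero_iff.2 hw)]
      have h3 := norm_sub_le (p₀ + ((|C| + ‖p₀‖ + 1) / ‖w‖) • w) p₀
      rw [add_sub_cancel_left, h2] at h3
      linarith [le_abs_self C]
    have hSbdd : BddBelow S := ⟨0, fun t ht => ht.1⟩
    set T := sInf S
    have hT : T ∈ S := hSclosed.csInf_mem hSne hSbdd
    have hT0 : 0 < T := by
      refine lt_of_le_of_ne hT.1 fun h0 => hT.2 ?_
      rw [← h0]
      simpa using hp₀W
    have hlt : ∀ t, 0 ≤ t → t < T → p₀ + t • w ∈ W := fun t h0 ht => by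
      by_contra hn
      exact absurd (csInf_le hSbdd ⟨h0, hn⟩) (not_le.2 ht)
    obtain ⟨j, hj⟩ : ∃ j, h j (p₀ + T • w) ≤ 0 := by
      by_contra hn
      push Not at hn
      exact hT.2 ((hW _).2 hn)
    have hcj : Continuous fun t : ℝ => h j (p₀ + t • w) := (hsm j).continuous.comp hcr
    -- Some h_j is at most 0 at the exit point, so h_j < t shortly before T. Then t ψ ≥ t / h_j ≥ 1,
    -- and the intermediate value theorem on [0, t] gives s ψ = 1, without a limit at the boundary.
    have hev : ∀ᶠ t in nhdsWithin T (Set.Iio T), h j (p₀ + t • w) < t :=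
      nhdsWithin_le_nhds <| hcj.continuousAt.eventually_lt continuousAt_id (hj.trans_lt hT0)
    have hev0 : ∀ᶠ t in nhdsWithin T (Set.Iio T), 0 < t :=
      nhdsWithin_le_nhds <| lt_mem_nhds hT0
    obtain ⟨t, ⟨htj, ht0⟩, htT⟩ :=
      ((hev.and hev0).and self_mem_nhdsWithin).exists
    have htT' : t < T := htT
    have hcont : ContinuousOn (fun s => s * ψ (p₀ + s • w)) (Set.Icc 0 t) := by
      intro s hs
      have hsW := hlt s hs.1 (hs.2.trans_lt htT')
      have h1 : ContinuousAt ψ (p₀ + s • w) := (hψsm _ hsW).continuousAt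
      exact (continuousAt_id.mul (h1.comp (f := fun s : ℝ => p₀ + s • w)
        hcr.continuousAt)).continuousWithinAt
    have htW := (hW _).1 (hlt t ht0.le htT')
    have hone : 1 ≤ t * ψ (p₀ + t • w) := by
      have h1 : (h j (p₀ + t • w))⁻¹ ≤ ψ (p₀ + t • w) :=
        Finset.single_le_sum (f := fun j => (h j (p₀ + t • w))⁻¹)
          (fun k _ => (inv_pos.2 (htW k)).le) (Finset.mem_univ j)
      calc (1 : ℝ) = t * t⁻¹ := (mul_inv_cancel₀ ht0.ne').symm
        _ ≤ t * (h j (p₀ + t • w))⁻¹ := by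
          gcongr
          exact htW j
        _ ≤ _ := by gcongr
    obtain ⟨s, hs, hs1⟩ := intermediate_value_Icc ht0.le hcont ⟨by simp, hone⟩
    refine ⟨p₀ + s • w, hlt s hs.1 (hs.2.trans_lt htT'), ?_⟩
    rw [add_sub_cancel_left, smul_smul, mul_comm]
    exact (congrArg (· • w) hs1).trans (one_smul ℝ w)

/-- A bounded star-shaped domain as in `nonempty_diffeomorph_of_star` is diffeomorphic to the open
unit ball. -/
theorem nonempty_diffeomorph_openUnitBall_of_star [FiniteDimensional ℝ E] {m : ℕ}
    (hm : Module.finrank ℝ E = m) {ι : Type*} [Fintype ι] [Nonempty ι]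
    (h : ι → E → ℝ) (hsm : ∀ j, ContDiff ℝ ∞ (h j)) (p₀ : E) (hp₀ : ∀ j, 0 < h j p₀)
    (hstar : ∀ j p, fderiv ℝ (h j) p (p - p₀) < h j p) (W : Opens E)
    (hW : ∀ p, p ∈ W ↔ ∀ j, 0 < h j p) (hbdd : Bornology.IsBounded (W : Set E)) :
    Nonempty (Diffeomorph 𝓘(ℝ, E) (𝓡 m) W (openUnitBall m) ∞) := by
  obtain ⟨e₁⟩ := nonempty_diffeomorph_of_star h hsm p₀ hp₀ hstar W hW hbdd
  obtain ⟨e₂⟩ := nonempty_diffeomorph_openUnitBall m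
  have L : E ≃L[ℝ] EuclideanSpace ℝ (Fin m) :=
    ContinuousLinearEquiv.ofFinrankEq (by simpa using hm)
  exact ⟨(e₁.trans L.toDiffeomorph).trans e₂⟩

end StarDomain

namespace CP2

/-! ### Affine coordinates -/

/-- The affine charts are smoothly compatible over `ℝ`. -/
instance instIsManifoldReal : IsManifold 𝓘(ℝ, Fin 2 → ℂ) ∞ CP2 := by
  apply isManifold_of_contDiffOn
  intro e e' he he'
  have h : e.symm ≫ₕ e' ∈ contDiffGroupoid ω 𝓘(ℂ, Fin 2 → ℂ) :=
    HasGroupoid.compatible he he'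
  rw [contDiffGroupoid, mem_groupoid_of_pregroupoid, contDiffPregroupoid] at h
  have h' : ContDiffOn ℂ ω (e.symm ≫ₕ e') ((e.symm ≫ₕ e').source) := by
    simpa using h.1
  simpa using (h'.restrict_scalars ℝ).of_le le_top

/-- Apart from the constant ratio z_k / z_k, these are components of an affine chart. The field is
left general to serve both holomorphy over ℂ and smoothness over ℝ. -/
theorem contMDiffOn_ratio (𝕜 : Type*) [NontriviallyNormedField 𝕜] [NormedAlgebra 𝕜 ℂ] (n : ℕ∞ω)
    [IsManifold 𝓘(𝕜, Fin 2 → ℂ) n CP2] (j k : Fin 3) :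
    ContMDiffOn 𝓘(𝕜, Fin 2 → ℂ) 𝓘(𝕜, ℂ) n (ratio j k) (chartDomain k) := by
  rcases Fin.eq_self_or_eq_succAbove k j with rfl | ⟨m, rfl⟩
  · refine contMDiffOn_const (c := (1 : ℂ)) |>.congr fun p hp => ?_
    induction p using Projectivization.ind with
    | h v hv => simpa using div_self hp
  · have h : ContMDiffOn 𝓘(𝕜, Fin 2 → ℂ) 𝓘(𝕜, Fin 2 → ℂ) n (affineChart k) (chartDomain k) :=
      contMDiffOn_of_mem_maximalAtlas (I := 𝓘(𝕜, Fin 2 → ℂ))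
        (IsManifold.subset_maximalAtlas ⟨k, rfl⟩)
    exact contMDiffOn_pi_space.1 h m

/-- Homogeneous coordinates of the point with `z_i / z_{i-1} = x` and `z_{i+1} / z_{i-1} = y`. -/
noncomputable def affineVec (i : Fin 3) (p : ℂ × ℂ) : Fin 3 → ℂ := fun l => ![1, p.1, p.2] (l - (i - 1))

@[simp] theorem affineVec_sub_one (i : Fin 3) (p : ℂ × ℂ) : affineVec i p (i - 1) = 1 := by
  simp [affineVec]

@[simp] theorem affineVec_self (i : Fin 3) (p : ℂ × ℂ) : affineVec i p i = p.1 := by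
  simp [affineVec]

@[simp] theorem affineVec_add_one (i : Fin 3) (p : ℂ × ℂ) : affineVec i p (i + 1) = p.2 := by
  have : i + 1 - (i - 1) = 2 := by revert i; decide
  simp [affineVec, this]

theorem affineVec_ne_zero (i : Fin 3) (p : ℂ × ℂ) : affineVec i p ≠ 0 := fun h => by
  have := congrFun h (i - 1)
  simp at this

/-- The point with `z_i / z_{i-1} = x` and `z_{i+1} / z_{i-1} = y`. -/
noncomputable def affinePoint (i : Fin 3) (p : ℂ × ℂ) : CP2 :=
  Projectivization.mk ℂ (affineVec i p) (affineVec_ne_zero i p)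

theorem affinePoint_mem_chartDomain (i : Fin 3) (p : ℂ × ℂ) :
    affinePoint i p ∈ chartDomain (i - 1) := by
  simp [affinePoint]

theorem ratio_affinePoint_fst (i : Fin 3) (p : ℂ × ℂ) :
    ratio i (i - 1) (affinePoint i p) = p.1 := by
  simp [affinePoint]

theorem ratio_affinePoint_snd (i : Fin 3) (p : ℂ × ℂ) :
    ratio (i + 1) (i - 1) (affinePoint i p) = p.2 := by
  simp [affinePoint]

theorem affinePoint_ratio (i : Fin 3) {p : CP2} (hp : p ∈ chartDomain (i - 1)) :
    affinePoint i (ratio i (i - 1) p, ratio (i + 1) (i - 1) p) = p := by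
  induction p using Projectivization.ind with
  | h v hv =>
    rw [mk_mem_chartDomain] at hp
    rw [affinePoint, Projectivization.mk_eq_mk_iff']
    refine ⟨(v (i - 1))⁻¹, ?_⟩
    ext l
    have hl : ∀ i l : Fin 3, l = i - 1 ∨ l = i ∨ l = i + 1 := by decide
    rcases hl i l with rfl | rfl | rfl <;> simp [hp, div_eq_inv_mul]

/-- The charts list the remaining coordinates in increasing order, `affinePoint` in cyclic order;
this comparison transfers smoothness from the charts. -/
theorem affinePoint_eq_affineChart_symm (i : Fin 3) (p : ℂ × ℂ) :
    affinePoint i p = (affineChart (i - 1)).symm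
      (fun j => affineVec i p ((i - 1).succAbove j)) := by
  have h : (i - 1).insertNth (1 : ℂ) (fun j => affineVec i p ((i - 1).succAbove j)) =
      affineVec i p := by
    rw [Fin.insertNth_eq_iff]
    exact ⟨(affineVec_sub_one i p).symm, rfl⟩
  change _ = Projectivization.mk ℂ _ _
  simp only [h]
  rfl

theorem contMDiff_affinePoint (i : Fin 3) :
    ContMDiff 𝓘(ℝ, ℂ × ℂ) 𝓘(ℝ, Fin 2 → ℂ) ∞ (affinePoint i) := by
  have h : ContMDiffOn 𝓘(ℝ, Fin 2 → ℂ) 𝓘(ℝ, Fin 2 → ℂ) ∞ (affineChart (i - 1)).symm Set.univ :=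
    contMDiffOn_symm_of_mem_maximalAtlas (I := 𝓘(ℝ, Fin 2 → ℂ))
      (IsManifold.subset_maximalAtlas ⟨i - 1, rfl⟩)
  have hv : ContDiff ℝ ∞ fun (p : ℂ × ℂ) (j : Fin 2) => affineVec i p ((i - 1).succAbove j) := by
    refine contDiff_pi.2 fun j => ?_
    simp only [affineVec]
    generalize (i - 1).succAbove j - (i - 1) = m
    fin_cases m
    · exact contDiff_const
    · exact contDiff_fst
    · exact contDiff_snd
  have := (contMDiffOn_univ.1 h).comp hv.contMDiff
  exact this.congr fun p => affinePoint_eq_affineChart_symm i p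

/-! ### The pieces in affine coordinates -/

variable {N : ℕ} {δ : ℝ} {i : Fin 3}

theorem affinePoint_mem_steinPiece (p : ℂ × ℂ) :
    affinePoint i p ∈ steinPiece N δ i ↔ ‖p.1‖ ^ (2 * N) + ‖p.2‖ ^ (2 * N) < 2 + δ := by
  change affinePoint i p ∈ chartDomain (i - 1) ∧ steinFun N i (affinePoint i p) < 2 + δ ↔ _
  rw [steinFun, ratio_affinePoint_fst, ratio_affinePoint_snd]
  exact and_iff_right (affinePoint_mem_chartDomain i p)

/-- The denominator of f_{i+1} is z_i, so multiplying by |x|^{2N} > 0 clears it. -/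
theorem affinePoint_mem_steinPiece_add_one (p : ℂ × ℂ) :
    affinePoint i p ∈ steinPiece N δ (i + 1) ↔
      p.1 ≠ 0 ∧ ‖p.2‖ ^ (2 * N) + 1 < (2 + δ) * ‖p.1‖ ^ (2 * N) := by
  change affinePoint i p ∈ chartDomain (i + 1 - 1) ∧
    steinFun N (i + 1) (affinePoint i p) < 2 + δ ↔ _
  have h1 : i + 1 + 1 = i - 1 := by revert i; decide
  rw [steinFun, h1, add_sub_cancel_right]
  simp only [affinePoint, mk_mem_chartDomain, ratio_mk, affineVec_self, affineVec_add_one,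
    affineVec_sub_one]
  refine and_congr_right fun hx => ?_
  have : 0 < ‖p.1‖ := norm_pos_iff.2 hx
  rw [norm_div, norm_div, norm_one, div_pow, div_pow, one_pow, ← add_div,
    div_lt_iff₀ (by positivity)]

theorem affinePoint_mem_steinPiece_add_two (p : ℂ × ℂ) :
    affinePoint i p ∈ steinPiece N δ (i + 2) ↔
      p.2 ≠ 0 ∧ 1 + ‖p.1‖ ^ (2 * N) < (2 + δ) * ‖p.2‖ ^ (2 * N) := by
  change affinePoint i p ∈ chartDomain (i + 2 - 1) ∧
    steinFun N (i + 2) (affinePoint i p) < 2 + δ ↔ _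
  have h1 : i + 2 - 1 = i + 1 := by revert i; decide
  have h2 : i + 2 = i - 1 := by revert i; decide
  rw [steinFun, h1, h2, sub_add_cancel]
  simp only [affinePoint, mk_mem_chartDomain, ratio_mk, affineVec_self, affineVec_add_one,
    affineVec_sub_one]
  refine and_congr_right fun hx => ?_
  have : 0 < ‖p.2‖ := norm_pos_iff.2 hx
  rw [norm_div, norm_div, norm_one, div_pow, div_pow, one_pow, ← add_div,
    div_lt_iff₀ (by positivity)]

theorem iSup_steinPiece (N : ℕ) {δ : ℝ} (hδ : 0 < δ) : ⨆ i, steinPiece N δ i = ⊤ := by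
  rw [eq_top_iff]
  intro p _
  induction p using Projectivization.ind with
  | h v hv =>
    obtain ⟨k, hk⟩ := Finite.exists_max fun l => ‖v l‖
    have hk0 : v k ≠ 0 := fun h0 => hv <| funext fun l => by
      have := hk l
      rw [h0, norm_zero] at this
      exact norm_le_zero_iff.1 this
    have hle : ∀ l, ‖v l / v k‖ ^ (2 * N) ≤ 1 := fun l => by
      refine pow_le_one₀ (norm_nonneg _) ?_
      rw [norm_div]
      exact div_le_one_of_le₀ (hk l) (norm_nonneg _)
    -- The piece whose denominator is the largest coordinate z_k has index k + 1.
    refine Opens.mem_iSup.2 ⟨k + 1, ?_, ?_⟩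
    · rwa [add_sub_cancel_right]
    · rw [steinFun, add_sub_cancel_right]
      simp only [ratio_mk]
      linarith [hle (k + 1), hle (k + 1 + 1)]

end CP2

/-! ### Model domains -/

section ModelDomains

/-- The even exponent makes this a power of |x|², hence smooth at 0 as well. -/
theorem contDiff_norm_pow_two_mul (N : ℕ) : ContDiff ℝ ∞ fun x : ℂ => ‖x‖ ^ (2 * N) := by
  simp_rw [pow_mul]
  exact (contDiff_norm_sq ℝ).pow N

theorem norm_le_of_pow_two_mul_le {E : Type*} [SeminormedAddGroup E] {N : ℕ} (hN : 1 ≤ N) {R : ℝ}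
    (hR : 1 ≤ R) {x : E} (hx : ‖x‖ ^ (2 * N) ≤ R) : ‖x‖ ≤ R := by
  by_contra hlt
  push Not at hlt
  have := le_self_pow₀ (hR.trans hlt.le) (show 2 * N ≠ 0 by omega)
  linarith

/-- Reduces the star condition to a one-variable derivative at t = 1 along the ray from p₀ through
p. -/
theorem fderiv_lt_of_hasDerivAt {E : Type*} [NormedAddCommGroup E] [NormedSpace ℝ E] {h : E → ℝ}
    {p₀ p : E} (hd : DifferentiableAt ℝ h p) {d : ℝ}
    (hder : HasDerivAt (fun t : ℝ => h (p₀ + t • (p - p₀))) d 1) (hlt : d < h p) :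
    fderiv ℝ h p (p - p₀) < h p := by
  have h1 : HasDerivAt (fun t : ℝ => p₀ + t • (p - p₀)) (p - p₀) 1 := by
    simpa using ((hasDerivAt_id (1 : ℝ)).smul_const (p - p₀)).const_add p₀
  have h2 := (show DifferentiableAt ℝ h (p₀ + (1 : ℝ) • (p - p₀)) by
    simpa using hd).hasFDerivAt.comp_hasDerivAt 1 h1
  rw [one_smul, add_sub_cancel] at h2
  rwa [hder.unique h2] at hlt

theorem hasDerivAt_norm_smul_pow (N : ℕ) (x : ℂ) :
    HasDerivAt (fun t : ℝ => ‖t • x‖ ^ (2 * N)) (2 * N * ‖x‖ ^ (2 * N)) 1 := by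
  have h : (fun t : ℝ => ‖t • x‖ ^ (2 * N)) = fun t : ℝ => t ^ (2 * N) * ‖x‖ ^ (2 * N) := by
    ext t
    rw [norm_smul, mul_pow, Real.norm_eq_abs, (even_two_mul N).pow_abs]
  rw [h]
  simpa using (hasDerivAt_pow (2 * N) (1 : ℝ)).mul_const (‖x‖ ^ (2 * N))

variable {N : ℕ} {R : ℝ}

/-- By homogeneity the radial derivative of |x|^{2N} is 2N|x|^{2N}; that it dominates |x|^{2N} is
what the star condition needs. -/
theorem norm_pow_le_two_mul (hN : 1 ≤ N) (x : ℂ) : ‖x‖ ^ (2 * N) ≤ 2 * N * ‖x‖ ^ (2 * N) := by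
  have h1 : (1 : ℝ) ≤ N := by exact_mod_cast hN
  have : 0 ≤ ‖x‖ ^ (2 * N) := by positivity
  nlinarith

/-- The domain `|x|^{2N} + |y|^{2N} < R` in `ℂ²` is a ball. -/
theorem nonempty_diffeomorph_fermatBall (hN : 1 ≤ N) (hR : 1 < R) (W : Opens (ℂ × ℂ))
    (hW : ∀ p, p ∈ W ↔ ‖p.1‖ ^ (2 * N) + ‖p.2‖ ^ (2 * N) < R) :
    Nonempty (Diffeomorph 𝓘(ℝ, ℂ × ℂ) (𝓡 4) W (openUnitBall 4) ∞) := by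
  have hsm : ContDiff ℝ ∞ fun p : ℂ × ℂ => R - (‖p.1‖ ^ (2 * N) + ‖p.2‖ ^ (2 * N)) :=
    contDiff_const.sub (((contDiff_norm_pow_two_mul N).comp contDiff_fst).add
      ((contDiff_norm_pow_two_mul N).comp contDiff_snd))
  refine nonempty_diffeomorph_openUnitBall_of_star (ι := Unit) (by simp)
    (fun _ p => R - (‖p.1‖ ^ (2 * N) + ‖p.2‖ ^ (2 * N))) (fun _ => hsm) 0 ?_ ?_ W ?_ ?_
  · intro _
    have : 2 * N ≠ 0 := by omega
    simp only [Prod.fst_zero, Prod.snd_zero, norm_zero, zero_pow this]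
    linarith
  · rintro - p
    refine fderiv_lt_of_hasDerivAt (hsm.differentiable (by simp) p)
      (d := 0 - (2 * N * ‖p.1‖ ^ (2 * N) + 2 * N * ‖p.2‖ ^ (2 * N))) ?_ ?_
    · simp only [zero_add, sub_zero]
      exact (hasDerivAt_const _ R).sub
        ((hasDerivAt_norm_smul_pow N p.1).add (hasDerivAt_norm_smul_pow N p.2))
    · have := norm_pow_le_two_mul hN p.1
      have := norm_pow_le_two_mul hN p.2
      linarith
  · intro p
    simp [hW]
  · refine isBounded_iff_forall_norm_le.2 ⟨R, fun p hp => ?_⟩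
    have hp' := (hW p).1 hp
    have h1 : 0 ≤ ‖p.1‖ ^ (2 * N) := by positivity
    have h2 : 0 ≤ ‖p.2‖ ^ (2 * N) := by positivity
    rw [Prod.norm_def]
    exact max_le (norm_le_of_pow_two_mul_le hN hR.le (by linarith))
      (norm_le_of_pow_two_mul_le hN hR.le (by linarith))

/-- The domain `|y|^{2N} < min (R - a) (R a - 1)` in `ℝ × ℂ` is a ball. -/
theorem nonempty_diffeomorph_lens (hN : 1 ≤ N) (hR : 2 < R) (W : Opens (ℝ × ℂ))
    (hW : ∀ p, p ∈ W ↔ p.1 + ‖p.2‖ ^ (2 * N) < R ∧ ‖p.2‖ ^ (2 * N) + 1 < R * p.1) :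
    Nonempty (Diffeomorph 𝓘(ℝ, ℝ × ℂ) (𝓡 3) W (openUnitBall 3) ∞) := by
  have hpow : ContDiff ℝ ∞ fun p : ℝ × ℂ => ‖p.2‖ ^ (2 * N) :=
    (contDiff_norm_pow_two_mul N).comp contDiff_snd
  let h : Bool → ℝ × ℂ → ℝ := fun b p =>
    bif b then R - (p.1 + ‖p.2‖ ^ (2 * N)) else R * p.1 - (‖p.2‖ ^ (2 * N) + 1)
  have hsm : ∀ b, ContDiff ℝ ∞ (h b) := by
    rintro (_ | _)
    · exact (contDiff_const.mul contDiff_fst).sub (hpow.add contDiff_const)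
    · exact contDiff_const.sub (contDiff_fst.add hpow)
  -- Both defining functions equal R - 1 at the base point (1, 0).
  refine nonempty_diffeomorph_openUnitBall_of_star (by simp) h hsm (1, 0) ?_ ?_ W ?_ ?_
  · have : 2 * N ≠ 0 := by omega
    rintro (_ | _) <;> simp [h, zero_pow this] <;> linarith
  · have hlin : ∀ p : ℝ × ℂ, HasDerivAt (fun t : ℝ => 1 + t * (p.1 - 1)) (p.1 - 1) 1 := fun p => by
      simpa using ((hasDerivAt_id (1 : ℝ)).mul_const (p.1 - 1)).const_add 1
    rintro (_ | _) p
    · refine fderiv_lt_of_hasDerivAt ((hsm _).differentiable (by simp) p)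
        (d := R * (p.1 - 1) - 2 * N * ‖p.2‖ ^ (2 * N)) ?_ ?_
      · simpa [h] using ((hlin p).const_mul R).fun_sub ((hasDerivAt_norm_smul_pow N p.2).add_const 1)
      · have := norm_pow_le_two_mul hN p.2
        change _ < R * p.1 - (‖p.2‖ ^ (2 * N) + 1)
        linarith
    · refine fderiv_lt_of_hasDerivAt ((hsm _).differentiable (by simp) p)
        (d := 0 - ((p.1 - 1) + 2 * N * ‖p.2‖ ^ (2 * N))) ?_ ?_
      · simpa [h] using (hasDerivAt_const _ R).fun_sub ((hlin p).fun_add (hasDerivAt_norm_smul_pow N p.2))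
      · have := norm_pow_le_two_mul hN p.2
        change _ < R - (p.1 + ‖p.2‖ ^ (2 * N))
        linarith
  · intro p
    rw [hW]
    simp [h, and_comm]
  · refine isBounded_iff_forall_norm_le.2 ⟨R, fun p hp => ?_⟩
    obtain ⟨hp1, hp2⟩ := (hW p).1 hp
    have h2 : 0 ≤ ‖p.2‖ ^ (2 * N) := by positivity
    have h1 : 0 < p.1 := by
      by_contra hn
      nlinarith
    rw [Prod.norm_def]
    refine max_le ?_ (norm_le_of_pow_two_mul_le hN (by linarith) (by linarith))
    rw [Real.norm_eq_abs, abs_le]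
    constructor <;> linarith

/-- Adding the inequalities gives (R - 1)(a + b) > 2, so a + b > 0; if one coordinate were
nonpositive, its inequality would make the other negative. -/
theorem pos_of_mem_triangle (hR : 2 < R) {p : ℝ × ℝ}
    (h1 : p.2 + 1 < R * p.1) (h2 : 1 + p.1 < R * p.2) : 0 < p.1 ∧ 0 < p.2 := by
  have hsum : 0 < p.1 + p.2 := by nlinarith
  constructor <;> by_contra hn <;> nlinarith

/-- The triangle `a + b < R`, `b + 1 < R a`, `1 + a < R b` is a disc. -/
theorem nonempty_diffeomorph_triangle (hR : 2 < R) (W : Opens (ℝ × ℝ))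
    (hW : ∀ p, p ∈ W ↔ p.1 + p.2 < R ∧ p.2 + 1 < R * p.1 ∧ 1 + p.1 < R * p.2) :
    Nonempty (Diffeomorph 𝓘(ℝ, ℝ × ℝ) (𝓡 2) W (openUnitBall 2) ∞) := by
  let h : Fin 3 → ℝ × ℝ → ℝ := ![fun p => R - (p.1 + p.2), fun p => R * p.1 - (p.2 + 1),
    fun p => R * p.2 - (1 + p.1)]
  have hsm : ∀ j, ContDiff ℝ ∞ (h j) := by
    intro j
    fin_cases j
    · exact contDiff_const.sub (contDiff_fst.add contDiff_snd)
    · exact (contDiff_const.mul contDiff_fst).sub (contDiff_snd.add contDiff_const)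
    · exact (contDiff_const.mul contDiff_snd).sub (contDiff_const.add contDiff_fst)
  -- The h_j are affine, so h_j(p) - Dh_j(p - p₀) is h_j(p₀) = R - 2, positive at (1, 1).
  refine nonempty_diffeomorph_openUnitBall_of_star (by simp) h hsm (1, 1) ?_ ?_ W ?_ ?_
  · intro j
    fin_cases j <;> simp [h] <;> linarith
  · have hlin : ∀ a : ℝ, HasDerivAt (fun t : ℝ => 1 + t * (a - 1)) (a - 1) 1 := fun a => by
      simpa using ((hasDerivAt_id (1 : ℝ)).mul_const (a - 1)).const_add 1
    intro j p
    fin_cases j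
    · refine fderiv_lt_of_hasDerivAt ((hsm _).differentiable (by simp) p)
        (d := 0 - ((p.1 - 1) + (p.2 - 1))) ?_ ?_
      · simpa [h] using (hasDerivAt_const _ R).fun_sub ((hlin p.1).fun_add (hlin p.2))
      · change _ < R - (p.1 + p.2)
        linarith
    · refine fderiv_lt_of_hasDerivAt ((hsm _).differentiable (by simp) p)
        (d := R * (p.1 - 1) - (p.2 - 1)) ?_ ?_
      · simpa [h] using ((hlin p.1).const_mul R).fun_sub ((hlin p.2).add_const 1)
      · change _ < R * p.1 - (p.2 + 1)
        linarith
    · refine fderiv_lt_of_hasDerivAt ((hsm _).differentiable (by simp) p)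
        (d := R * (p.2 - 1) - (p.1 - 1)) ?_ ?_
      · simpa [h] using ((hlin p.2).const_mul R).fun_sub ((hlin p.1).const_add 1)
      · change _ < R * p.2 - (1 + p.1)
        linarith
  · intro p
    rw [hW, Fin.forall_fin_succ, Fin.forall_fin_two]
    simp [h]
  · refine isBounded_iff_forall_norm_le.2 ⟨R, fun p hp => ?_⟩
    obtain ⟨h1, h2, h3⟩ := (hW p).1 hp
    obtain ⟨ha, hb⟩ := pos_of_mem_triangle hR h2 h3
    rw [Prod.norm_def, Real.norm_of_nonneg ha.le, Real.norm_of_nonneg hb.le]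
    exact max_le (by linarith) (by linarith)

end ModelDomains

/-! ### Polar coordinates -/

section Polar

attribute [local instance] finrank_real_complex_fact'

/-- The direction `x / |x|` of a nonzero complex number. -/
noncomputable def circleDir (x : ℂ) : Circle := Circle.exp x.arg

theorem norm_mul_coe_circleDir (x : ℂ) : (‖x‖ : ℂ) * circleDir x = x := by
  rw [circleDir, Circle.coe_exp, Complex.norm_mul_exp_arg_mul_I]

theorem coe_circleDir {x : ℂ} (hx : x ≠ 0) : (circleDir x : ℂ) = x / ‖x‖ := by
  rw [eq_div_iff (by simpa using hx), mul_comm, norm_mul_coe_circleDir]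

theorem circleDir_mul {r : ℝ} (hr : 0 < r) (u : Circle) : circleDir (r * u) = u := by
  have hne : (r : ℂ) * u ≠ 0 := mul_ne_zero (by exact_mod_cast hr.ne') u.coe_ne_zero
  ext
  rw [coe_circleDir hne, norm_mul, Circle.norm_coe, mul_one, Complex.norm_of_nonneg hr.le,
    mul_div_cancel_left₀]
  exact_mod_cast hr.ne'

/-- The argument jumps across its branch cut, so smoothness is read off from x / |x| as a map into
the sphere. -/
theorem ContMDiff.circleDir {E H M : Type*} [NormedAddCommGroup E] [NormedSpace ℝ E]
    [TopologicalSpace H] {I : ModelWithCorners ℝ E H} [TopologicalSpace M] [ChartedSpace H M]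
    [IsManifold I ∞ M] {f : M → ℂ} (hf : ContMDiff I 𝓘(ℝ, ℂ) ∞ f) (h0 : ∀ p, f p ≠ 0) :
    ContMDiff I (𝓡 1) ∞ fun p => circleDir (f p) := by
  have hdiv : ∀ x : ℂ, x ≠ 0 → ContDiffAt ℝ ∞ (fun x : ℂ => (‖x‖⁻¹ : ℝ) • x) x := fun x hx =>
    ((contDiffAt_norm ℝ hx).inv (norm_ne_zero_iff.2 hx)).smul contDiffAt_id
  have hg : ContMDiff I 𝓘(ℝ, ℂ) ∞ fun p => (‖f p‖⁻¹ : ℝ) • f p := fun p =>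
    (hdiv _ (h0 p)).contMDiffAt.comp p (hf p)
  have hs : ∀ p, (‖f p‖⁻¹ : ℝ) • f p ∈ Metric.sphere (0 : ℂ) 1 := fun p => by
    have := norm_ne_zero_iff.2 (h0 p)
    simp [this]
  refine (hg.codRestrict_sphere (n := 1) hs).congr fun p => ?_
  apply Circle.ext
  rw [coe_circleDir (h0 p)]
  change _ = (‖f p‖⁻¹ : ℝ) • f p
  rw [Complex.real_smul, div_eq_inv_mul, Complex.ofReal_inv]

theorem contMDiff_coe_circle : ContMDiff (𝓡 1) 𝓘(ℝ, ℂ) ∞ (fun u : Circle => (u : ℂ)) :=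
  contMDiff_coe_sphere (E := ℂ)

/-- The inverse of the function `r ↦ r ^ (2 * N)` on positive numbers. -/
noncomputable def evenRoot (N : ℕ) (a : ℝ) : ℝ := a ^ (((2 * N : ℕ) : ℝ)⁻¹)

theorem evenRoot_pos (N : ℕ) {a : ℝ} (ha : 0 < a) : 0 < evenRoot N a := Real.rpow_pos_of_pos ha _

theorem evenRoot_pow {N : ℕ} (hN : 1 ≤ N) {a : ℝ} (ha : 0 < a) : evenRoot N a ^ (2 * N) = a :=
  Real.rpow_inv_natCast_pow ha.le (by omega)

theorem evenRoot_norm_pow {N : ℕ} (hN : 1 ≤ N) (x : ℂ) : evenRoot N (‖x‖ ^ (2 * N)) = ‖x‖ :=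
  Real.pow_rpow_inv_natCast (norm_nonneg x) (by omega)

theorem contDiffAt_evenRoot (N : ℕ) {a : ℝ} (ha : 0 < a) : ContDiffAt ℝ ∞ (evenRoot N) a :=
  Real.contDiffAt_rpow_const_of_ne ha.ne'

/-- The complex number with direction `u` and `|x| ^ (2 * N) = a`. -/
noncomputable def polarPoint (N : ℕ) (u : Circle) (a : ℝ) : ℂ := evenRoot N a * u

theorem polarPoint_circleDir {N : ℕ} (hN : 1 ≤ N) (x : ℂ) :
    polarPoint N (circleDir x) (‖x‖ ^ (2 * N)) = x := by
  rw [polarPoint, evenRoot_norm_pow hN, norm_mul_coe_circleDir]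

theorem circleDir_polarPoint (N : ℕ) (u : Circle) {a : ℝ} (ha : 0 < a) :
    circleDir (polarPoint N u a) = u :=
  circleDir_mul (evenRoot_pos N ha) u

theorem norm_polarPoint_pow {N : ℕ} (hN : 1 ≤ N) (u : Circle) {a : ℝ} (ha : 0 < a) :
    ‖polarPoint N u a‖ ^ (2 * N) = a := by
  rw [polarPoint, norm_mul, Circle.norm_coe, mul_one,
    Complex.norm_of_nonneg (evenRoot_pos N ha).le, evenRoot_pow hN ha]

theorem polarPoint_ne_zero (N : ℕ) (u : Circle) {a : ℝ} (ha : 0 < a) : polarPoint N u a ≠ 0 :=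
  mul_ne_zero (by exact_mod_cast (evenRoot_pos N ha).ne') u.coe_ne_zero

theorem ContMDiff.polarPoint {E H M : Type*} [NormedAddCommGroup E] [NormedSpace ℝ E]
    [TopologicalSpace H] {I : ModelWithCorners ℝ E H} [TopologicalSpace M] [ChartedSpace H M]
    {u : M → Circle} {a : M → ℝ} (hu : ContMDiff I (𝓡 1) ∞ u) (ha : ContMDiff I 𝓘(ℝ, ℝ) ∞ a)
    (h0 : ∀ p, 0 < a p) (N : ℕ) : ContMDiff I 𝓘(ℝ, ℂ) ∞ fun p => polarPoint N (u p) (a p) := by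
  have h1 : ContMDiff I 𝓘(ℝ, ℝ) ∞ fun p => evenRoot N (a p) := fun p =>
    (contDiffAt_evenRoot N (h0 p)).contMDiffAt.comp p (ha p)
  have h2 : ContMDiff I 𝓘(ℝ, ℂ) ∞ fun p => (u p : ℂ) := contMDiff_coe_circle.comp hu
  exact (h1.smul h2).congr fun p => by simp [_root_.polarPoint]

end Polar

/-- Multiplying a diffeomorphism with the identity of a manifold `M`. -/
def Diffeomorph.prodRight {𝕜 E E₁ E₂ H H₁ H₂ N₁ N₂ : Type*} [NontriviallyNormedField 𝕜]
    [NormedAddCommGroup E] [NormedSpace 𝕜 E] [NormedAddCommGroup E₁] [NormedSpace 𝕜 E₁]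
    [NormedAddCommGroup E₂] [NormedSpace 𝕜 E₂] [TopologicalSpace H] [TopologicalSpace H₁]
    [TopologicalSpace H₂] {J₁ : ModelWithCorners 𝕜 E₁ H₁} {J₂ : ModelWithCorners 𝕜 E₂ H₂}
    [TopologicalSpace N₁] [ChartedSpace H₁ N₁] [TopologicalSpace N₂] [ChartedSpace H₂ N₂]
    {n : ℕ∞ω} (e : Diffeomorph J₁ J₂ N₁ N₂ n) (I : ModelWithCorners 𝕜 E H) (M : Type*)
    [TopologicalSpace M] [ChartedSpace H M] :
    Diffeomorph (I.prod J₁) (I.prod J₂) (M × N₁) (M × N₂) n where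
  toEquiv := (Equiv.refl M).prodCongr e.toEquiv
  contMDiff_toFun := contMDiff_fst.prodMk (e.contMDiff.comp contMDiff_snd)
  contMDiff_invFun := contMDiff_fst.prodMk (e.symm.contMDiff.comp contMDiff_snd)

/-! ### The pieces and their intersections up to diffeomorphism -/

namespace CP2

variable {N : ℕ} {δ : ℝ}

theorem contMDiff_ratio_restrict (U : Opens CP2) (j k : Fin 3) (hU : ∀ p ∈ U, p ∈ chartDomain k) :
    ContMDiff 𝓘(ℝ, Fin 2 → ℂ) 𝓘(ℝ, ℂ) ∞ fun p : U => ratio j k p :=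
  (contMDiffOn_ratio ℝ ∞ j k).comp_contMDiff contMDiff_subtype_val fun p => hU p p.2

theorem ratio_mem_of_mem {i : Fin 3} {p : CP2} (hp : p ∈ steinPiece N δ i) {U : Set CP2}
    (hU : p ∈ U) : affinePoint i (ratio i (i - 1) p, ratio (i + 1) (i - 1) p) ∈ U := by
  rwa [affinePoint_ratio i hp.1]

theorem nonempty_diffeomorph_steinPiece (hN : 1 ≤ N) (hδ : 0 < δ) (i : Fin 3) :
    Nonempty (Diffeomorph 𝓘(ℝ, Fin 2 → ℂ) (𝓡 4) (steinPiece N δ i) (openUnitBall 4) ∞) := by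
  let W : Opens (ℂ × ℂ) := ⟨{p | ‖p.1‖ ^ (2 * N) + ‖p.2‖ ^ (2 * N) < 2 + δ},
    isOpen_lt (by fun_prop) (by fun_prop)⟩
  obtain ⟨e⟩ := nonempty_diffeomorph_fermatBall hN (by linarith : 1 < 2 + δ) W fun _ => Iff.rfl
  have hU : ∀ p ∈ steinPiece N δ i, p ∈ chartDomain (i - 1) := fun p hp => hp.1
  let d : Diffeomorph 𝓘(ℝ, Fin 2 → ℂ) 𝓘(ℝ, ℂ × ℂ) (steinPiece N δ i) W ∞ :=
    { toFun := fun p => ⟨(ratio i (i - 1) p, ratio (i + 1) (i - 1) p), p.2.2⟩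
      invFun := fun q => ⟨affinePoint i q, (affinePoint_mem_steinPiece q.1).2 q.2⟩
      left_inv := fun p => Subtype.ext (affinePoint_ratio i p.2.1)
      right_inv := fun q => Subtype.ext <|
        Prod.ext (ratio_affinePoint_fst i q) (ratio_affinePoint_snd i q)
      contMDiff_toFun := by
        rw [← ContMDiff.subtypeVal_comp_iff]
        exact (contMDiff_ratio_restrict _ _ _ hU).prodMk_space (contMDiff_ratio_restrict _ _ _ hU)
      contMDiff_invFun := by
        rw [← ContMDiff.subtypeVal_comp_iff]
        exact (contMDiff_affinePoint i).comp contMDiff_subtype_val }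
  exact ⟨d.trans e⟩

/-- The map is (x, y) ↦ (x/|x|, (|x|^{2N}, y)). Only x is known to be nonzero, so y stays a complex
coordinate. -/
theorem nonempty_diffeomorph_steinPiece_inf (hN : 1 ≤ N) (hδ : 0 < δ) (i : Fin 3) :
    Nonempty (Diffeomorph 𝓘(ℝ, Fin 2 → ℂ) ((𝓡 1).prod (𝓡 3))
      (steinPiece N δ i ⊓ steinPiece N δ (i + 1) : Opens CP2) (Circle × openUnitBall 3) ∞) := by
  let W : Opens (ℝ × ℂ) := ⟨{p | p.1 + ‖p.2‖ ^ (2 * N) < 2 + δ ∧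
      ‖p.2‖ ^ (2 * N) + 1 < (2 + δ) * p.1},
    (isOpen_lt (by fun_prop) (by fun_prop)).and (isOpen_lt (by fun_prop) (by fun_prop))⟩
  obtain ⟨e⟩ := nonempty_diffeomorph_lens hN (by linarith : 2 < 2 + δ) W fun _ => Iff.rfl
  have hW : ∀ q ∈ W, 0 < q.1 := fun q hq => by
    have h1 : 0 ≤ ‖q.2‖ ^ (2 * N) := by positivity
    have h2 : ‖q.2‖ ^ (2 * N) + 1 < (2 + δ) * q.1 := hq.2
    by_contra hn
    nlinarith
  set U : Opens CP2 := steinPiece N δ i ⊓ steinPiece N δ (i + 1)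
  have hU : ∀ p ∈ U, p ∈ chartDomain (i - 1) := fun p hp => hp.1.1
  have hmem : ∀ p ∈ U, ratio i (i - 1) p ≠ 0 ∧
      (‖ratio i (i - 1) p‖ ^ (2 * N), ratio (i + 1) (i - 1) p) ∈ W := fun p hp => by
    have h2 := (affinePoint_mem_steinPiece_add_one _).1 (ratio_mem_of_mem hp.1 hp.2)
    exact ⟨h2.1, hp.1.2, h2.2⟩
  have hmem' : ∀ q : Circle × W, affinePoint i (polarPoint N q.1 q.2.1.1, q.2.1.2) ∈ U :=
      fun q => by
    have hpos := hW _ q.2.2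
    refine ⟨(affinePoint_mem_steinPiece _).2 ?_, (affinePoint_mem_steinPiece_add_one _).2
      ⟨polarPoint_ne_zero N _ hpos, ?_⟩⟩
    · rw [norm_polarPoint_pow hN _ hpos]
      exact q.2.2.1
    · rw [norm_polarPoint_pow hN _ hpos]
      exact q.2.2.2
  have hx := contMDiff_ratio_restrict U i (i - 1) hU
  have hy := contMDiff_ratio_restrict U (i + 1) (i - 1) hU
  let d : Diffeomorph 𝓘(ℝ, Fin 2 → ℂ) ((𝓡 1).prod 𝓘(ℝ, ℝ × ℂ)) U (Circle × W) ∞ :=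
    { toFun := fun p => (circleDir (ratio i (i - 1) p),
        ⟨(‖ratio i (i - 1) p‖ ^ (2 * N), ratio (i + 1) (i - 1) p), (hmem p p.2).2⟩)
      invFun := fun q => ⟨affinePoint i (polarPoint N q.1 q.2.1.1, q.2.1.2), hmem' q⟩
      left_inv := fun p => Subtype.ext <| by
        simp only [polarPoint_circleDir hN]
        exact affinePoint_ratio i p.2.1.1
      right_inv := fun q => by
        have hpos := hW _ q.2.2
        refine Prod.ext ?_ (Subtype.ext (Prod.ext ?_ ?_))
        · simp only [ratio_affinePoint_fst]
          exact circleDir_polarPoint N _ hpos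
        · simp only [ratio_affinePoint_fst]
          exact norm_polarPoint_pow hN _ hpos
        · exact ratio_affinePoint_snd i _
      contMDiff_toFun := by
        refine (hx.circleDir fun p => (hmem p p.2).1).prodMk ?_
        rw [← ContMDiff.subtypeVal_comp_iff]
        exact ((contDiff_norm_pow_two_mul N).comp_contMDiff hx).prodMk_space hy
      contMDiff_invFun := by
        rw [← ContMDiff.subtypeVal_comp_iff]
        have hw : ContMDiff ((𝓡 1).prod 𝓘(ℝ, ℝ × ℂ)) 𝓘(ℝ, ℝ × ℂ) ∞
            fun q : Circle × W => (q.2 : ℝ × ℂ) := contMDiff_subtype_val.comp contMDiff_snd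
        exact (contMDiff_affinePoint i).comp <| ContMDiff.prodMk_space
          (contMDiff_fst.polarPoint (contDiff_fst.comp_contMDiff hw) (fun q => hW _ q.2.2) N)
          (contDiff_snd.comp_contMDiff hw) }
  exact ⟨d.trans (e.prodRight (𝓡 1) Circle)⟩

theorem nonempty_diffeomorph_steinPiece_inf_inf (hN : 1 ≤ N) (hδ : 0 < δ) (i : Fin 3) :
    Nonempty (Diffeomorph 𝓘(ℝ, Fin 2 → ℂ) (((𝓡 1).prod (𝓡 1)).prod (𝓡 2))
      (steinPiece N δ i ⊓ steinPiece N δ (i + 1) ⊓ steinPiece N δ (i + 2) : Opens CP2)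
      ((Circle × Circle) × openUnitBall 2) ∞) := by
  let W : Opens (ℝ × ℝ) := ⟨{p | p.1 + p.2 < 2 + δ ∧ p.2 + 1 < (2 + δ) * p.1 ∧
      1 + p.1 < (2 + δ) * p.2},
    (isOpen_lt (by fun_prop) (by fun_prop)).and
      ((isOpen_lt (by fun_prop) (by fun_prop)).and (isOpen_lt (by fun_prop) (by fun_prop)))⟩
  have hR : 2 < 2 + δ := by linarith
  obtain ⟨e⟩ := nonempty_diffeomorph_triangle hR W fun _ => Iff.rfl
  have hW : ∀ q ∈ W, 0 < q.1 ∧ 0 < q.2 := fun q hq => pos_of_mem_triangle hR hq.2.1 hq.2.2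
  set U : Opens CP2 := steinPiece N δ i ⊓ steinPiece N δ (i + 1) ⊓ steinPiece N δ (i + 2)
  have hU : ∀ p ∈ U, p ∈ chartDomain (i - 1) := fun p hp => hp.1.1.1
  have hmem : ∀ p ∈ U, ratio i (i - 1) p ≠ 0 ∧ ratio (i + 1) (i - 1) p ≠ 0 ∧
      (‖ratio i (i - 1) p‖ ^ (2 * N), ‖ratio (i + 1) (i - 1) p‖ ^ (2 * N)) ∈ W := fun p hp => by
    have h2 := (affinePoint_mem_steinPiece_add_one _).1 (ratio_mem_of_mem hp.1.1 hp.1.2)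
    have h3 := (affinePoint_mem_steinPiece_add_two _).1 (ratio_mem_of_mem hp.1.1 hp.2)
    exact ⟨h2.1, h3.1, hp.1.1.2, h2.2, h3.2⟩
  have hmem' : ∀ q : (Circle × Circle) × W,
      affinePoint i (polarPoint N q.1.1 q.2.1.1, polarPoint N q.1.2 q.2.1.2) ∈ U := fun q => by
    obtain ⟨hpos1, hpos2⟩ := hW _ q.2.2
    refine ⟨⟨(affinePoint_mem_steinPiece _).2 ?_, (affinePoint_mem_steinPiece_add_one _).2
      ⟨polarPoint_ne_zero N _ hpos1, ?_⟩⟩, (affinePoint_mem_steinPiece_add_two _).2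
      ⟨polarPoint_ne_zero N _ hpos2, ?_⟩⟩
    all_goals rw [norm_polarPoint_pow hN _ hpos1, norm_polarPoint_pow hN _ hpos2]
    · exact q.2.2.1
    · exact q.2.2.2.1
    · exact q.2.2.2.2
  have hx := contMDiff_ratio_restrict U i (i - 1) hU
  have hy := contMDiff_ratio_restrict U (i + 1) (i - 1) hU
  let d : Diffeomorph 𝓘(ℝ, Fin 2 → ℂ) (((𝓡 1).prod (𝓡 1)).prod 𝓘(ℝ, ℝ × ℝ)) U
      ((Circle × Circle) × W) ∞ :=
    { toFun := fun p => ((circleDir (ratio i (i - 1) p), circleDir (ratio (i + 1) (i - 1) p)),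
        ⟨(‖ratio i (i - 1) p‖ ^ (2 * N), ‖ratio (i + 1) (i - 1) p‖ ^ (2 * N)), (hmem p p.2).2.2⟩)
      invFun := fun q =>
        ⟨affinePoint i (polarPoint N q.1.1 q.2.1.1, polarPoint N q.1.2 q.2.1.2), hmem' q⟩
      left_inv := fun p => Subtype.ext <| by
        simp only [polarPoint_circleDir hN]
        exact affinePoint_ratio i p.2.1.1.1
      right_inv := fun q => by
        obtain ⟨hpos1, hpos2⟩ := hW _ q.2.2
        refine Prod.ext (Prod.ext ?_ ?_) (Subtype.ext (Prod.ext ?_ ?_)) <;>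
          simp only [ratio_affinePoint_fst, ratio_affinePoint_snd]
        · exact circleDir_polarPoint N _ hpos1
        · exact circleDir_polarPoint N _ hpos2
        · exact norm_polarPoint_pow hN _ hpos1
        · exact norm_polarPoint_pow hN _ hpos2
      contMDiff_toFun := by
        refine ((hx.circleDir fun p => (hmem p p.2).1).prodMk
          (hy.circleDir fun p => (hmem p p.2).2.1)).prodMk ?_
        rw [← ContMDiff.subtypeVal_comp_iff]
        exact ((contDiff_norm_pow_two_mul N).comp_contMDiff hx).prodMk_space
          ((contDiff_norm_pow_two_mul N).comp_contMDiff hy)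
      contMDiff_invFun := by
        rw [← ContMDiff.subtypeVal_comp_iff]
        have hw : ContMDiff (((𝓡 1).prod (𝓡 1)).prod 𝓘(ℝ, ℝ × ℝ)) 𝓘(ℝ, ℝ × ℝ) ∞
            fun q : (Circle × Circle) × W => (q.2 : ℝ × ℝ) :=
          contMDiff_subtype_val.comp contMDiff_snd
        exact (contMDiff_affinePoint i).comp <| ContMDiff.prodMk_space
          ((contMDiff_fst.comp contMDiff_fst).polarPoint (contDiff_fst.comp_contMDiff hw)
            (fun q => (hW _ q.2.2).1) N)
          ((contMDiff_snd.comp contMDiff_fst).polarPoint (contDiff_snd.comp_contMDiff hw)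
            (fun q => (hW _ q.2.2).2) N) }
  exact ⟨d.trans (e.prodRight ((𝓡 1).prod (𝓡 1)) (Circle × Circle))⟩

end CP2

/-! ### The pieces are Stein -/

namespace CP2

variable {N : ℕ} {δ : ℝ} {i : Fin 3}

theorem isHolomorphicFun_ratio (U : Opens CP2) (j k : Fin 3) (hU : ∀ p ∈ U, p ∈ chartDomain k) :
    IsHolomorphicFun 2 U fun p => ratio j k p := by
  have h : ContMDiff 𝓘(ℂ, Fin 2 → ℂ) 𝓘(ℂ, ℂ) ω fun p : U => ratio j k p :=
    (contMDiffOn_ratio ℂ ω j k).comp_contMDiff contMDiff_subtype_val fun p => hU p p.2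
  exact h.mdifferentiable (by simp)

theorem isHolomorphicFun_comp (U : Opens CP2) (hU : ∀ p ∈ U, p ∈ chartDomain (i - 1))
    {g : ℂ × ℂ → ℂ} (hg : Differentiable ℂ g) :
    IsHolomorphicFun 2 U fun p => g (ratio i (i - 1) p, ratio (i + 1) (i - 1) p) :=
  hg.mdifferentiable.comp
    ((isHolomorphicFun_ratio U i (i - 1) hU).prodMk_space
      (isHolomorphicFun_ratio U (i + 1) (i - 1) hU))

theorem _root_.isClosed_holomorphicHull (n : ℕ) (M : Type*) [TopologicalSpace M]
    [ChartedSpace (Fin n → ℂ) M] (K : Set M) : IsClosed (holomorphicHull n M K) := by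
  simp only [holomorphicHull, Set.ofPred_forall]
  refine isClosed_iInter fun f => isClosed_iInter fun hf => isClosed_iInter fun C =>
    isClosed_iInter fun _ => isClosed_le ?_ continuous_const
  exact (MDifferentiable.continuous hf).norm

/-- Since c < 2 + δ, the closed bounded set |x|^{2N} + |y|^{2N} ≤ c in ℂ² lands inside the piece. -/
theorem isCompact_steinFun_le (hN : 1 ≤ N) {c : ℝ} (hc : c < 2 + δ) :
    IsCompact {p : steinPiece N δ i | steinFun N i p ≤ c} := by
  set B : Set (ℂ × ℂ) := {q | ‖q.1‖ ^ (2 * N) + ‖q.2‖ ^ (2 * N) ≤ c}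
  have hB : IsCompact B := by
    refine Metric.isCompact_of_isClosed_isBounded
      (isClosed_le (by fun_prop) continuous_const) ?_
    refine isBounded_iff_forall_norm_le.2 ⟨max 1 c, fun q hq => ?_⟩
    have hq' : ‖q.1‖ ^ (2 * N) + ‖q.2‖ ^ (2 * N) ≤ max 1 c := le_trans hq (le_max_right _ _)
    have h1 : 0 ≤ ‖q.1‖ ^ (2 * N) := by positivity
    have h2 : 0 ≤ ‖q.2‖ ^ (2 * N) := by positivity
    rw [Prod.norm_def]
    exact max_le (norm_le_of_pow_two_mul_le hN (le_max_left _ _) (by linarith))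
      (norm_le_of_pow_two_mul_le hN (le_max_left _ _) (by linarith))
  rw [Subtype.isCompact_iff]
  convert hB.image (contMDiff_affinePoint i).continuous using 1
  ext p
  constructor
  · rintro ⟨⟨p, hp⟩, hpc, rfl⟩
    exact ⟨_, hpc, affinePoint_ratio i hp.1⟩
  · rintro ⟨q, hq, rfl⟩
    have hq' : ‖q.1‖ ^ (2 * N) + ‖q.2‖ ^ (2 * N) ≤ c := hq
    refine ⟨⟨affinePoint i q, (affinePoint_mem_steinPiece q).2 (hq'.trans_lt hc)⟩, ?_, rfl⟩
    change steinFun N i (affinePoint i q) ≤ c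
    rwa [steinFun, ratio_affinePoint_fst, ratio_affinePoint_snd]

/-- Cauchy–Schwarz in ℂ² for the vectors (x^N, y^N) and (z^N, w^N). -/
theorem norm_conj_pow_mul_add_sq_le (N : ℕ) (x y z w : ℂ) :
    ‖(starRingEnd ℂ x) ^ N * z ^ N + (starRingEnd ℂ y) ^ N * w ^ N‖ ^ 2 ≤
      (‖x‖ ^ (2 * N) + ‖y‖ ^ (2 * N)) * (‖z‖ ^ (2 * N) + ‖w‖ ^ (2 * N)) := by
  have h : ‖(starRingEnd ℂ x) ^ N * z ^ N + (starRingEnd ℂ y) ^ N * w ^ N‖ ≤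
      ‖x‖ ^ N * ‖z‖ ^ N + ‖y‖ ^ N * ‖w‖ ^ N := by
    refine (norm_add_le _ _).trans_eq ?_
    simp only [norm_mul, norm_pow, RCLike.norm_conj]
  refine (pow_le_pow_left₀ (norm_nonneg _) h 2).trans ?_
  simp only [mul_comm 2 N, pow_mul]
  nlinarith [sq_nonneg (‖x‖ ^ N * ‖w‖ ^ N - ‖y‖ ^ N * ‖z‖ ^ N)]

/-- The holomorphic hull of a set on which `f_i ≤ c` is contained in `f_i ≤ c`. -/
theorem steinFun_le_of_mem_holomorphicHull {c : ℝ} {K : Set (steinPiece N δ i)}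
    (hK : ∀ q ∈ K, steinFun N i q ≤ c) (hc : 0 ≤ c) {p : steinPiece N δ i}
    (hp : p ∈ holomorphicHull 2 (steinPiece N δ i) K) : steinFun N i p ≤ c := by
  set x := ratio i (i - 1) p.1
  set y := ratio (i + 1) (i - 1) p.1
  have hs : steinFun N i p = ‖x‖ ^ (2 * N) + ‖y‖ ^ (2 * N) := rfl
  set s := steinFun N i p
  have hs0 : 0 ≤ s := by rw [hs]; positivity
  -- The test function has coefficients taken from p itself: its value at p is s, while its modulus
  -- on K is at most √(s c). So s² ≤ s c.
  have hhol := isHolomorphicFun_comp (i := i) (steinPiece N δ i) (fun p hp => hp.1)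
    (g := fun q => (starRingEnd ℂ x) ^ N * q.1 ^ N + (starRingEnd ℂ y) ^ N * q.2 ^ N)
    (by fun_prop)
  have hle := hp _ hhol (√(s * c)) fun q hq => by
    refine Real.le_sqrt_of_sq_le ((norm_conj_pow_mul_add_sq_le N _ _ _ _).trans ?_)
    rw [← hs]
    exact mul_le_mul_of_nonneg_left (hK q hq) hs0
  have hval : ‖(starRingEnd ℂ x) ^ N * x ^ N + (starRingEnd ℂ y) ^ N * y ^ N‖ = s := by
    rw [← mul_pow, ← mul_pow, Complex.conj_mul', Complex.conj_mul', ← pow_mul, ← pow_mul]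
    rw [hs] at hs0 ⊢
    rw [← Complex.norm_of_nonneg hs0]
    push_cast
    rfl
  have hle' : s ≤ √(s * c) := hval.symm.trans_le hle
  rcases hs0.eq_or_lt with h0 | h0
  · rwa [← h0]
  · rw [Real.le_sqrt hs0 (by positivity), sq] at hle'
    exact le_of_mul_le_mul_left hle' h0

theorem continuous_steinFun_restrict :
    Continuous fun p : steinPiece N δ i => steinFun N i p := by
  have hr : ∀ j, Continuous fun p : steinPiece N δ i => ratio j (i - 1) p := fun j =>
    (continuousOn_ratio j (i - 1)).comp_continuous continuous_subtype_val fun p => p.2.1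
  exact ((hr i).norm.pow _).add ((hr (i + 1)).norm.pow _)

theorem isCompact_holomorphicHull_steinPiece (hN : 1 ≤ N) (hδ : 0 < δ)
    {K : Set (steinPiece N δ i)} (hK : IsCompact K) :
    IsCompact (holomorphicHull 2 (steinPiece N δ i) K) := by
  obtain ⟨c, hc0, hc, hKc⟩ : ∃ c, 0 ≤ c ∧ c < 2 + δ ∧ ∀ q ∈ K, steinFun N i q ≤ c := by
    rcases K.eq_empty_or_nonempty with rfl | hne
    · exact ⟨0, le_rfl, by linarith, by simp⟩
    · obtain ⟨q, -, hq⟩ := hK.exists_isMaxOn hne continuous_steinFun_restrict.continuousOn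
      refine ⟨steinFun N i q, ?_, q.2.2, fun r hr => hq hr⟩
      rw [steinFun]
      positivity
  exact (isCompact_steinFun_le hN hc).of_isClosed_subset (isClosed_holomorphicHull _ _ _)
    fun p hp => steinFun_le_of_mem_holomorphicHull hKc hc0 hp

theorem isSteinManifold_steinPiece (hN : 1 ≤ N) (hδ : 0 < δ) (i : Fin 3)
    [T2Space (steinPiece N δ i)] [ParacompactSpace (steinPiece N δ i)] :
    IsSteinManifold 2 (steinPiece N δ i) where
  t2Space := inferInstance
  paracompactSpace := inferInstance
  holomorphicallyConvex _ hK := isCompact_holomorphicHull_steinPiece hN hδ hK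
  separatesPoints p q hpq := by
    by_contra! hne
    have h := fun j => hne _ (isHolomorphicFun_ratio (steinPiece N δ i) j (i - 1) fun p hp => hp.1)
    refine hpq (Subtype.ext ?_)
    rw [← affinePoint_ratio i p.2.1, ← affinePoint_ratio i q.2.1, h i, h (i + 1)]
  localCoordinates p :=
    ⟨fun j q => ratio ((i - 1).succAbove j) (i - 1) q,
      fun j => isHolomorphicFun_ratio _ _ _ fun p hp => hp.1,
      (affineChart (i - 1)).subtypeRestr ⟨p⟩,
      StructureGroupoid.subtypeRestr_mem_maximalAtlas (Set.mem_range_self (i - 1)) _,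
      by
        rw [OpenPartialHomeomorph.subtypeRestr_source]
        exact p.2.1,
      fun _ _ _ => rfl⟩

end CP2

theorem proposition1p9 (N : ℕ) (hN : 1 ≤ N) (δ : ℝ) (hδ : 0 < δ) :
    IsSteinTrisectionOneZero (CP2.steinPiece N δ) where
  stein i := by
    -- The ball is Hausdorff and paracompact, and both properties pass through the homeomorphism.
    obtain ⟨e⟩ := CP2.nonempty_diffeomorph_steinPiece hN hδ i
    have : T2Space (CP2.steinPiece N δ i) := e.toHomeomorph.symm.t2Space
    have : ParacompactSpace (CP2.steinPiece N δ i) :=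
      e.toHomeomorph.isClosedEmbedding.paracompactSpace
    exact CP2.isSteinManifold_steinPiece hN hδ i
  cover := CP2.iSup_steinPiece N hδ
  piece := CP2.nonempty_diffeomorph_steinPiece hN hδ
  double := CP2.nonempty_diffeomorph_steinPiece_inf hN hδ
  -- For i = 0 the indices i + 1 and i + 2 reduce to 1 and 2.
  triple := CP2.nonempty_diffeomorph_steinPiece_inf_inf hN hδ 0
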